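/- Let $\lambda\ge 1$ be an integer and $d=2\lambda+2$. For $n\ge 0$ let $W_n^\lambda(x)={}_2F_1\big(-n,n+2\lambda;\lambda+\tfrac12;\tfrac{1-x}2\big)$ be the Gegenbauer polynomial of degree $n$ and order $\lambda$, normalized so that $W_n^\lambda(1)=1$; let $[f,g]_\lambda=\int_{-1}^1 f(x)g(x)(1-x^2)^{\lambda-1/2}\,dx$; and let $N_{d,n}=\binom{n+d-1}{n}-\binom{n+d-3}{n-2}$ (the second binomial being $0$ for $n<2$) be the dimension of the space of spherical harmonics of degree $n$ on $\mathbb S^{d-1}$. The thinplate spline function $k_{d,1}$ is the function that is continuous on $[-1,1)$, integrable on $[-1,1]$ with respect to $(1-x^2)^{\lambda-1/2}\,dx$, and has the orthogonal expansion $$k_{d,1}\sim\sum_{n=1}^\infty \frac{N_{d,n}}{n(n+d-2)}\,W_n^\lambda ,$$ that is, $[k_{d,1},W_0^\lambda]_\lambda=0$ and $[k_{d,1},W_n^\lambda]_\lambda/[W_n^\lambda,W_n^\lambda]_\lambda=N_{d,n}/(n(n+d-2))$ for all $n\ge1$. Such a function exists, and every such function satisfies, for all $x\in(-1,1)$, with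 $v=\frac{\pi}{2}+\arcsin x$, $$k_{d,1}(x)=x\,v\sum_{j=1}^{\lambda}c_j^\lambda(1-x^2)^{-j+\frac12}+\sum_{j=1}^{\lambda-1}d_j^\lambda(1-x^2)^{-j}-C_\lambda ,$$ where $$c_j^\lambda=\frac1{2\lambda}\,\frac1{2j-1}\,\frac{(2j-1)!!}{(2j-2)!!}\quad(1\le j\le\lambda),$$ $$d_j^\lambda=\frac1{2j}\left[\frac{(2\lambda-1)!!}{(2\lambda-2j-1)!!}\,\frac{(2\lambda-2j-2)!!}{(2\lambda)!!}-\frac1{2\lambda}\,\frac{(2j-1)!!}{(2j)!!}\right]\quad(1\le j\le\lambda-1),$$ $$C_\lambda=\frac1{f_{\lambda-\frac12}}\left(\sum_{j=1}^{\lambda}\frac{c_j^\lambda}{2(\lambda-j+1)}\,f_{\lambda-j+\frac12}+\sum_{j=1}^{\lambda-1}d_j^\lambda\,f_{\lambda-j-\frac12}\right),$$ with $0!!=1$ and the Beta integrals $$f_\mu=\int_{-1}^1(1-y^2)^\mu\,dy=\frac{\sqrt\pi\,\Gamma(\mu+1)}{\Gamma(\mu+\frac32)},\qquad \mu>-1 .$$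 -/

import Mathlib

open MeasureTheory Set

noncomputable section

/-- The Gegenbauer (zonal) polynomial of degree `n` and order `lam`, normalized to be `1` at `x = 1`:
`W_n^lam(x) = ₂F₁(-n, n + 2 lam; lam + 1/2; (1 - x)/2)`.  The usual Gegenbauer polynomial is
`C_n^lam(x) = Γ(n + 2 lam) / (n! Γ(2 lam)) * W_n^lam(x)`, so that `W_n^lam = C_n^lam / C_n^lam(1)`. -/
def gegenbauerW (lam : ℝ) (n : ℕ) (x : ℝ) : ℝ :=
  ordinaryHypergeometric (-(n : ℝ)) ((n : ℝ) + 2 * lam) (lam + 1 / 2) ((1 - x) / 2)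

/-- The bilinear form `[f, g]_lam = ∫_{-1}^1 f g (1 - x²)^(lam - 1/2) dx`. -/
def gegenbauerInner (lam : ℝ) (f g : ℝ → ℝ) : ℝ :=
  ∫ x in (-1 : ℝ)..1, f x * g x * (1 - x ^ 2) ^ (lam - 1 / 2)

/-- The coefficient of `W_n^lam` in the orthogonal (Fourier--Gegenbauer) expansion of `f`. -/
def gegenbauerCoeff (lam : ℝ) (f : ℝ → ℝ) (n : ℕ) : ℝ :=
  gegenbauerInner lam f (gegenbauerW lam n) /
    gegenbauerInner lam (gegenbauerW lam n) (gegenbauerW lam n)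

/-- `f ∼ ∑ a_n W_n^lam`: the function `f` is in `L¹([-1,1], (1 - x²)^(lam - 1/2) dx)` and
`a` is the sequence of its Fourier--Gegenbauer coefficients. -/
def HasGegenbauerExpansion (lam : ℝ) (f : ℝ → ℝ) (a : ℕ → ℝ) : Prop :=
  IntegrableOn (fun x => f x * (1 - x ^ 2) ^ (lam - 1 / 2)) (Ioo (-1 : ℝ) 1) ∧
    ∀ n, gegenbauerCoeff lam f n = a n

/-- The dimension `N_{d,n} = C(n+d-1, n) - C(n+d-3, n-2)` of the space of spherical harmonics of
degree `n` on the unit sphere of `ℝ^d`; the second binomial is `0` for `n < 2`. -/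
def sphericalHarmonicDim (d n : ℕ) : ℝ :=
  ((n + d - 1).choose n : ℝ) - (if 2 ≤ n then ((n + d - 3).choose (n - 2) : ℝ) else 0)

/-- `k` is the thinplate spline function `k_{d,m}` of the sphere `S^{d-1}`: it is continuous on
`[-1, 1)` and, with `lam = (d-2)/2`, has the orthogonal expansion
`k ∼ ∑_{n ≥ 1} [n (n+d-2)]^(-m) N_{d,n} W_n^lam`. -/
def IsThinplateSplineFunction (d m : ℕ) (k : ℝ → ℝ) : Prop :=
  ContinuousOn k (Ico (-1 : ℝ) 1) ∧
    HasGegenbauerExpansion (((d : ℝ) - 2) / 2) k (fun n =>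
      if n = 0 then 0
      else (((n : ℝ) * ((n : ℝ) + (d : ℝ) - 2)) ^ m)⁻¹ * sphericalHarmonicDim d n)

/-- `c_j^l = (1/(2l)) (1/(2j-1)) (2j-1)!!/(2j-2)!!`, for `1 ≤ j ≤ l`. -/
def tpsC (l j : ℕ) : ℝ :=
  1 / (2 * (l : ℝ)) * (1 / (2 * (j : ℝ) - 1)) *
    ((Nat.doubleFactorial (2 * j - 1) : ℝ) / (Nat.doubleFactorial (2 * j - 2) : ℝ))

/-- `d_j^l = (1/(2j)) [ (2l-1)!!/(2l-2j-1)!! (2l-2j-2)!!/(2l)!! - (1/(2l)) (2j-1)!!/(2j)!! ]`,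
for `1 ≤ j ≤ l - 1`. -/
def tpsD (l j : ℕ) : ℝ :=
  1 / (2 * (j : ℝ)) *
    ((Nat.doubleFactorial (2 * l - 1) : ℝ) / (Nat.doubleFactorial (2 * l - 2 * j - 1) : ℝ) *
        ((Nat.doubleFactorial (2 * l - 2 * j - 2) : ℝ) / (Nat.doubleFactorial (2 * l) : ℝ)) -
      1 / (2 * (l : ℝ)) *
        ((Nat.doubleFactorial (2 * j - 1) : ℝ) / (Nat.doubleFactorial (2 * j) : ℝ)))

/-- The Beta integral `f_μ = ∫_{-1}^1 (1 - y²)^μ dy`, for `μ > -1`. -/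
def tpsBeta (mu : ℝ) : ℝ := ∫ y in (-1 : ℝ)..1, (1 - y ^ 2) ^ mu

/-- The constant `C_l`. -/
def tpsConst (l : ℕ) : ℝ :=
  1 / tpsBeta ((l : ℝ) - 1 / 2) *
    (∑ j ∈ Finset.Icc 1 l,
        1 / (2 * ((l : ℝ) - (j : ℝ) + 1)) * tpsC l j * tpsBeta ((l : ℝ) - (j : ℝ) + 1 / 2) +
      ∑ j ∈ Finset.Icc 1 (l - 1), tpsD l j * tpsBeta ((l : ℝ) - (j : ℝ) - 1 / 2))

end

/-! Write `w = (1 - x²)^(λ - 1/2)`, let `K` be the claimed closed form, and let `Φ` be the primitive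
of `w` vanishing at `-1`. The closed form is a Green's function: `(1 - x²)^(λ + 1/2) K' = Φ` on
`(-1, 1)`. The polynomials satisfy the Sturm–Liouville equation `((1 - x²)^(λ + 1/2) W_n')' = -n(n +
2λ) w W_n`. Green's identity leaves only the boundary term at `1`, so `n(n + 2λ)[K, W_n] + [1, W_n]
= Φ(1) W_n(1) = f_{λ - 1/2}` (`integral_tpsWeighted_mul_gegenbauerPoly`).

For `n ≥ 1` the term `[1, W_n]` vanishes. Since `N_{d,n} [W_n, W_n] = f_{λ - 1/2}` for every `n`
(`sphericalHarmonicDim_mul_gegenbauerInner_self`), the coefficients of `K` are the required ones.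
The constant `C_λ` is what makes `[K, W_0]` zero (`integral_tpsWeighted`).

Uniqueness holds because the `W_n` span all polynomials, and an integrable function on an interval
orthogonal to every polynomial vanishes almost everywhere (`eqOn_of_gegenbauerInner_eq`). For
existence, `K'` is bounded near `-1`, so `K` extends continuously to that endpoint
(`exists_continuousOn_eqOn_tpsClosedForm`). -/

/-! ### Gegenbauer polynomials: derivative, differential equation, span -/

open Polynomial in
/-- The polynomial `₂F₁(-n, n + 2 lam; lam + 1/2; X)`. -/
noncomputable def gegenbauerHypPoly (lam : ℝ) (n : ℕ) : ℝ[X] :=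
  ∑ k ∈ Finset.range (n + 1), monomial k
    (ordinaryHypergeometricCoefficient (-(n : ℝ)) ((n : ℝ) + 2 * lam) (lam + 1 / 2) k)

open Polynomial in
/-- The Gegenbauer polynomial `gegenbauerW lam n` as an element of `ℝ[X]`. -/
noncomputable def gegenbauerPoly (lam : ℝ) (n : ℕ) : ℝ[X] :=
  (gegenbauerHypPoly lam n).comp (C (1 / 2) - C (1 / 2) * X)

theorem ascPochhammer_eval_neg_natCast_eq_zero {n k : ℕ} (h : n < k) :
    (ascPochhammer ℝ k).eval (-(n : ℝ)) = 0 := by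
  rw [ascPochhammer_eval_eq_zero_iff]
  exact ⟨n, h, by simp⟩

theorem gegenbauerHypPoly_coeff (lam : ℝ) (n k : ℕ) :
    (gegenbauerHypPoly lam n).coeff k =
      ordinaryHypergeometricCoefficient (-(n : ℝ)) ((n : ℝ) + 2 * lam) (lam + 1 / 2) k := by
  rw [gegenbauerHypPoly, Polynomial.finsetSum_coeff]
  simp only [Polynomial.coeff_monomial, Finset.sum_ite_eq', Finset.mem_range]
  split_ifs with h
  · rfl
  · simp [ordinaryHypergeometricCoefficient,
      ascPochhammer_eval_neg_natCast_eq_zero (show n < k by omega)]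

theorem gegenbauerW_eq_eval (lam : ℝ) (n : ℕ) (x : ℝ) :
    gegenbauerW lam n x = (gegenbauerPoly lam n).eval x := by
  rw [gegenbauerW, ordinaryHypergeometric_eq_tsum, gegenbauerPoly, Polynomial.eval_comp,
    gegenbauerHypPoly, Polynomial.eval_finsetSum]
  have hx : Polynomial.eval x (Polynomial.C (1 / 2) - Polynomial.C (1 / 2) * Polynomial.X) =
      (1 - x) / 2 := by simp; ring
  beta_reduce
  rw [hx, tsum_eq_sum (s := Finset.range (n + 1))]
  · simp [ordinaryHypergeometricCoefficient]
  · intro k hk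
    rw [ascPochhammer_eval_neg_natCast_eq_zero (by simpa using hk)]
    simp

theorem ordinaryHypergeometricCoefficient_succ {a b c : ℝ} (k : ℕ) (hc : c + k ≠ 0) :
    ((k : ℝ) + 1) * (c + k) * ordinaryHypergeometricCoefficient a b c (k + 1) =
      (a + k) * (b + k) * ordinaryHypergeometricCoefficient a b c k := by
  simp only [ordinaryHypergeometricCoefficient, ascPochhammer_succ_eval, Nat.factorial_succ,
    Nat.cast_mul, mul_inv]
  push_cast
  field_simp

theorem ascPochhammer_succ_eval_left (a : ℝ) (k : ℕ) :
    (ascPochhammer ℝ (k + 1)).eval a = a * (ascPochhammer ℝ k).eval (a + 1) := by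
  simp [ascPochhammer_succ_left, Polynomial.eval_comp]

theorem ordinaryHypergeometricCoefficient_succ_shift {a b c : ℝ} (k : ℕ) (hc : c ≠ 0) :
    ((k : ℝ) + 1) * ordinaryHypergeometricCoefficient a b c (k + 1) =
      a * b / c * ordinaryHypergeometricCoefficient (a + 1) (b + 1) (c + 1) k := by
  simp only [ordinaryHypergeometricCoefficient, ascPochhammer_succ_eval_left, Nat.factorial_succ,
    Nat.cast_mul, mul_inv]
  push_cast
  field_simp

-- Differentiating a hypergeometric series shifts all three parameters by one, which here amounts to
-- `n + 1 ↦ n` and `lam ↦ lam + 1`.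
open Polynomial in
theorem derivative_gegenbauerHypPoly_succ {lam : ℝ} (hlam : 0 ≤ lam) (n : ℕ) :
    derivative (gegenbauerHypPoly lam (n + 1)) =
      C (-(2 * ((n + 1) * (n + 1 + 2 * lam) / (2 * lam + 1)))) *
        gegenbauerHypPoly (lam + 1) n := by
  ext k
  rw [coeff_derivative, coeff_C_mul, gegenbauerHypPoly_coeff, gegenbauerHypPoly_coeff, mul_comm,
    ordinaryHypergeometricCoefficient_succ_shift k (by positivity)]
  have h1 : -((n + 1 : ℕ) : ℝ) + 1 = -n := by push_cast; ring
  have h2 : ((n + 1 : ℕ) : ℝ) + 2 * lam + 1 = n + 2 * (lam + 1) := by push_cast; ring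
  have h3 : lam + 1 / 2 + 1 = lam + 1 + 1 / 2 := by ring
  rw [h1, h2, h3]
  congr 1
  push_cast
  field_simp

open Polynomial in
theorem derivative_gegenbauerPoly_succ {lam : ℝ} (hlam : 0 ≤ lam) (n : ℕ) :
    derivative (gegenbauerPoly lam (n + 1)) =
      C ((n + 1) * (n + 1 + 2 * lam) / (2 * lam + 1)) * gegenbauerPoly (lam + 1) n := by
  rw [gegenbauerPoly, derivative_comp, derivative_gegenbauerHypPoly_succ hlam, gegenbauerPoly]
  simp only [derivative_sub, derivative_C, derivative_mul, derivative_X, mul_comp, C_comp]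
  simp only [zero_mul, mul_one, zero_add, zero_sub, ← mul_assoc, ← C_neg, ← C_mul]
  congr 2
  ring

open Polynomial in
theorem gegenbauerHypPoly_ode {lam : ℝ} (hlam : 0 ≤ lam) (n : ℕ) :
    (X - X ^ 2) * derivative (derivative (gegenbauerHypPoly lam n)) +
      (C (lam + 1 / 2) - C (2 * lam + 1) * X) * derivative (gegenbauerHypPoly lam n) +
      C (n * (n + 2 * lam)) * gegenbauerHypPoly lam n = 0 := by
  ext k
  have key := ordinaryHypergeometricCoefficient_succ (a := -(n : ℝ)) (b := n + 2 * lam)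
    (c := lam + 1 / 2) k (by positivity)
  -- Factors of `X` are split off one at a time, so that each coefficient is a shift. The double
  -- factor of `X` is why degrees 0 and 1 are treated separately; the recursion used is the same in
  -- all three cases.
  have e : (X - X ^ 2) * derivative (derivative (gegenbauerHypPoly lam n)) +
      (C (lam + 1 / 2) - C (2 * lam + 1) * X) * derivative (gegenbauerHypPoly lam n) +
      C (n * (n + 2 * lam)) * gegenbauerHypPoly lam n =
      X * derivative (derivative (gegenbauerHypPoly lam n)) -
        X * (X * derivative (derivative (gegenbauerHypPoly lam n))) +
      C (lam + 1 / 2) * derivative (gegenbauerHypPoly lam n) -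
        C (2 * lam + 1) * (X * derivative (gegenbauerHypPoly lam n)) +
      C (n * (n + 2 * lam)) * gegenbauerHypPoly lam n := by ring
  rw [e]
  simp only [coeff_add, coeff_sub, coeff_C_mul, coeff_zero]
  rcases k with _ | _ | k
  · simp only [coeff_X_mul_zero, coeff_derivative, gegenbauerHypPoly_coeff]
    push_cast at key ⊢
    linear_combination key
  · simp only [coeff_X_mul_zero, coeff_X_mul, coeff_derivative, gegenbauerHypPoly_coeff]
    push_cast at key ⊢
    linear_combination key
  · simp only [coeff_X_mul, coeff_derivative, gegenbauerHypPoly_coeff]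
    push_cast at key ⊢
    linear_combination key

open Polynomial in
theorem gegenbauerPoly_ode {lam : ℝ} (hlam : 0 ≤ lam) (n : ℕ) (x : ℝ) :
    (1 - x ^ 2) * (derivative (derivative (gegenbauerPoly lam n))).eval x -
      (2 * lam + 1) * x * (derivative (gegenbauerPoly lam n)).eval x +
      n * (n + 2 * lam) * (gegenbauerPoly lam n).eval x = 0 := by
  have h := congrArg (eval ((1 - x) / 2)) (gegenbauerHypPoly_ode hlam n)
  have hx : eval x (C (1 / 2) - C (1 / 2) * X) = (1 - x) / 2 := by simp; ring
  simp only [gegenbauerPoly, derivative_comp, derivative_mul, derivative_sub, derivative_C,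
    derivative_X, eval_mul, eval_add, eval_sub, eval_comp, hx, eval_C, eval_X, eval_pow, eval_zero,
    eval_one] at h ⊢
  simp only [zero_mul, zero_add, mul_one, derivative_C, derivative_zero, zero_sub,
    eval_zero] at h ⊢
  linear_combination h

theorem gegenbauerPoly_zero (lam : ℝ) : gegenbauerPoly lam 0 = 1 := by
  simp [gegenbauerPoly, gegenbauerHypPoly, ordinaryHypergeometricCoefficient]

theorem gegenbauerPoly_eval_one (lam : ℝ) (n : ℕ) : (gegenbauerPoly lam n).eval 1 = 1 := by
  rw [← gegenbauerW_eq_eval, gegenbauerW]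
  simp

-- By induction on `n` through the derivative, which lowers the degree by one and raises `lam`;
-- hence the generalization over `lam`.
open Polynomial in
theorem gegenbauerPoly_degree {lam : ℝ} (hlam : 0 ≤ lam) (n : ℕ) :
    (gegenbauerPoly lam n).degree = n := by
  induction n generalizing lam with
  | zero => simp [gegenbauerPoly_zero]
  | succ n ih =>
    have h := congrArg degree (derivative_gegenbauerPoly_succ hlam n)
    rw [degree_C_mul (by positivity), ih (by positivity)] at h
    have hpos : 0 < (gegenbauerPoly lam (n + 1)).natDegree := by
      by_contra h0
      rw [derivative_of_natDegree_zero (by omega), degree_zero] at h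
      exact absurd h.symm (by simp)
    have h2 := natDegree_eq_of_degree_eq_some h
    rw [natDegree_derivative] at h2
    rw [degree_eq_natDegree (fun h0 => by simp [h0] at hpos)]
    congr 1
    omega

theorem gegenbauerPoly_span {lam : ℝ} (hlam : 0 ≤ lam) :
    Submodule.span ℝ (range (gegenbauerPoly lam)) = ⊤ := by
  have h := Polynomial.Sequence.span (R := ℝ)
    ⟨gegenbauerPoly lam, gegenbauerPoly_degree hlam⟩ ?_
  · exact h
  · intro i
    rw [isUnit_iff_ne_zero, Polynomial.leadingCoeff_ne_zero]
    exact Polynomial.Sequence.ne_zero _ i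

/-! ### Sturm–Liouville form, orthogonality to constants, recursions for norms and Beta integrals -/

theorem one_sub_sq_rpow_eq_mul {x : ℝ} (hx : x ∈ Icc (-1 : ℝ) 1) {p : ℝ} (hp : 0 < p) :
    (1 - x ^ 2) ^ (p + 1) = (1 - x ^ 2) * (1 - x ^ 2) ^ p := by
  have h0 : 0 ≤ 1 - x ^ 2 := by nlinarith [hx.1, hx.2]
  rw [Real.rpow_add_of_nonneg h0 hp.le zero_le_one, Real.rpow_one, mul_comm]

theorem hasDerivAt_one_sub_sq_rpow {p x : ℝ} (h : 1 - x ^ 2 ≠ 0 ∨ 1 ≤ p) :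
    HasDerivAt (fun y : ℝ => (1 - y ^ 2) ^ p) (-(2 * p) * x * (1 - x ^ 2) ^ (p - 1)) x := by
  have h1 : HasDerivAt (fun y : ℝ => 1 - y ^ 2) (-(2 * x)) x := by
    simpa using (hasDerivAt_pow 2 x).const_sub 1
  convert h1.rpow_const h using 1
  ring

theorem continuous_one_sub_sq_rpow {p : ℝ} (hp : 0 ≤ p) :
    Continuous (fun y : ℝ => (1 - y ^ 2) ^ p) :=
  (by fun_prop : Continuous fun y : ℝ => 1 - y ^ 2).rpow_const fun _ => Or.inr hp

/-- The differential equation in divergence form. Since `lam + 1/2 ≥ 1`, it remains valid at the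
endpoints. -/
theorem gegenbauerPoly_hasDerivAt_weighted {lam : ℝ} (hlam : 1 ≤ lam) (n : ℕ) {x : ℝ}
    (hx : x ∈ Icc (-1 : ℝ) 1) :
    HasDerivAt (fun y : ℝ => (1 - y ^ 2) ^ (lam + 1 / 2) *
        (Polynomial.derivative (gegenbauerPoly lam n)).eval y)
      (-(n * (n + 2 * lam)) * ((gegenbauerPoly lam n).eval x * (1 - x ^ 2) ^ (lam - 1 / 2))) x := by
  have h1 := hasDerivAt_one_sub_sq_rpow (p := lam + 1 / 2) (x := x) (Or.inr (by linarith))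
  have h2 := (Polynomial.derivative (gegenbauerPoly lam n)).hasDerivAt x
  refine (h1.fun_mul h2).congr_deriv ?_
  have h3 : lam + 1 / 2 = lam - 1 / 2 + 1 := by ring
  have h4 := one_sub_sq_rpow_eq_mul hx (p := lam - 1 / 2) (by linarith)
  rw [h3, h4, add_sub_cancel_right]
  linear_combination ((1 - x ^ 2) ^ (lam - 1 / 2)) *
    gegenbauerPoly_ode (lam := lam) (by linarith) n x

theorem one_sub_sq_rpow_one {p : ℝ} (hp : 0 < p) : (1 - (1 : ℝ) ^ 2) ^ p = 0 := by
  norm_num; exact Real.zero_rpow hp.ne'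

theorem one_sub_sq_rpow_neg_one {p : ℝ} (hp : 0 < p) : (1 - (-1 : ℝ) ^ 2) ^ p = 0 := by
  norm_num; exact Real.zero_rpow hp.ne'

theorem continuous_polynomial_mul_weight {lam : ℝ} (hlam : 1 ≤ lam) (p : Polynomial ℝ) :
    Continuous fun x : ℝ => p.eval x * (1 - x ^ 2) ^ (lam - 1 / 2) :=
  p.continuous.mul (continuous_one_sub_sq_rpow (by linarith))

theorem integral_gegenbauerPoly_mul_weight {lam : ℝ} (hlam : 1 ≤ lam) {n : ℕ} (hn : n ≠ 0) :
    ∫ x in (-1 : ℝ)..1, (gegenbauerPoly lam n).eval x * (1 - x ^ 2) ^ (lam - 1 / 2) = 0 := by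
  have hc := continuous_polynomial_mul_weight hlam (gegenbauerPoly lam n)
  have h := intervalIntegral.integral_eq_sub_of_hasDerivAt (a := -1) (b := 1)
    (fun x hx => gegenbauerPoly_hasDerivAt_weighted hlam n
      (by rwa [uIcc_of_le (by norm_num)] at hx))
    ((hc.const_mul (-(n * (n + 2 * lam)))).intervalIntegrable _ _)
  rw [intervalIntegral.integral_const_mul] at h
  rw [one_sub_sq_rpow_one (by linarith), one_sub_sq_rpow_neg_one (by linarith)] at h
  have hn' : (0 : ℝ) < n := by positivity
  have : (n * (n + 2 * lam)) ≠ 0 := by positivity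
  simpa [this] using h

theorem gegenbauerInner_self_eq (lam : ℝ) (n : ℕ) :
    gegenbauerInner lam (gegenbauerW lam n) (gegenbauerW lam n) =
      ∫ x in (-1 : ℝ)..1, (gegenbauerPoly lam n).eval x ^ 2 * (1 - x ^ 2) ^ (lam - 1 / 2) := by
  simp only [gegenbauerInner, gegenbauerW_eq_eval, sq]

/-- Integrate the derivative of `(1 - x²)^(lam + 1/2) P P'`: the boundary terms vanish, and `P'` is
a multiple of the polynomial of degree `n` and order `lam + 1`. -/
theorem gegenbauerInner_self_succ {lam : ℝ} (hlam : 1 ≤ lam) (n : ℕ) :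
    gegenbauerInner lam (gegenbauerW lam (n + 1)) (gegenbauerW lam (n + 1)) =
      (n + 1) * (n + 1 + 2 * lam) / (2 * lam + 1) ^ 2 *
        gegenbauerInner (lam + 1) (gegenbauerW (lam + 1) n) (gegenbauerW (lam + 1) n) := by
  rw [gegenbauerInner_self_eq, gegenbauerInner_self_eq]
  set P := gegenbauerPoly lam (n + 1) with hP
  set Q := gegenbauerPoly (lam + 1) n with hQ
  have hd : Polynomial.derivative P = _ := derivative_gegenbauerPoly_succ (by linarith) n
  have hc1 : Continuous fun x : ℝ => P.eval x ^ 2 * (1 - x ^ 2) ^ (lam - 1 / 2) :=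
    (P.continuous.pow 2).mul (continuous_one_sub_sq_rpow (by linarith))
  have hc2 : Continuous fun x : ℝ => Q.eval x ^ 2 * (1 - x ^ 2) ^ (lam + 1 - 1 / 2) :=
    (Q.continuous.pow 2).mul (continuous_one_sub_sq_rpow (by linarith))
  set A : ℝ := (n + 1) * (n + 1 + 2 * lam) with hA
  have hA0 : A ≠ 0 := by positivity
  have h := intervalIntegral.integral_eq_sub_of_hasDerivAt (a := -1) (b := 1)
    (f := fun y => P.eval y * ((1 - y ^ 2) ^ (lam + 1 / 2) * (Polynomial.derivative P).eval y))
    (f' := fun x => (A / (2 * lam + 1)) ^ 2 * (Q.eval x ^ 2 * (1 - x ^ 2) ^ (lam + 1 - 1 / 2)) -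
      A * (P.eval x ^ 2 * (1 - x ^ 2) ^ (lam - 1 / 2)))
    (fun x hx => ?_)
    (((hc2.const_mul _).sub (hc1.const_mul _)).intervalIntegrable _ _)
  · rw [intervalIntegral.integral_sub ((hc2.const_mul _).intervalIntegrable _ _)
      ((hc1.const_mul _).intervalIntegrable _ _), intervalIntegral.integral_const_mul,
      intervalIntegral.integral_const_mul, one_sub_sq_rpow_one (by linarith),
      one_sub_sq_rpow_neg_one (by linarith)] at h
    apply mul_left_cancel₀ hA0
    rw [div_pow] at h
    linear_combination -h
  · rw [uIcc_of_le (by norm_num)] at hx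
    have h1 := (P.hasDerivAt x).fun_mul (gegenbauerPoly_hasDerivAt_weighted hlam (n + 1) hx)
    refine h1.congr_deriv ?_
    rw [← hP, hd, Polynomial.eval_mul, Polynomial.eval_C,
      show lam + 1 - 1 / 2 = lam + 1 / 2 by ring]
    simp only [hA]
    push_cast
    ring

theorem tpsBeta_succ {mu : ℝ} (hmu : 0 < mu) :
    (2 * mu + 3) * tpsBeta (mu + 1) = (2 * mu + 2) * tpsBeta mu := by
  have hc1 := continuous_one_sub_sq_rpow (p := mu + 1) (by linarith)
  have hc2 := continuous_one_sub_sq_rpow hmu.le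
  have h := intervalIntegral.integral_eq_sub_of_hasDerivAt (a := -1) (b := 1)
    (f := fun y => y * (1 - y ^ 2) ^ (mu + 1))
    (f' := fun x => (2 * mu + 3) * (1 - x ^ 2) ^ (mu + 1) - (2 * mu + 2) * (1 - x ^ 2) ^ mu)
    (fun x hx => ?_)
    (((hc1.const_mul _).sub (hc2.const_mul _)).intervalIntegrable _ _)
  · rw [intervalIntegral.integral_sub ((hc1.const_mul _).intervalIntegrable _ _)
      ((hc2.const_mul _).intervalIntegrable _ _), intervalIntegral.integral_const_mul,
      intervalIntegral.integral_const_mul, one_sub_sq_rpow_one (by linarith),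
      one_sub_sq_rpow_neg_one (by linarith)] at h
    rw [tpsBeta, tpsBeta]
    linear_combination h
  · rw [uIcc_of_le (by norm_num)] at hx
    refine ((hasDerivAt_id' x).fun_mul
      (hasDerivAt_one_sub_sq_rpow (p := mu + 1) (x := x) (Or.inr (by linarith)))).congr_deriv ?_
    rw [add_sub_cancel_right, one_sub_sq_rpow_eq_mul hx hmu]
    ring

theorem tpsBeta_pos {mu : ℝ} (hmu : 0 < mu) : 0 < tpsBeta mu := by
  apply intervalIntegral.intervalIntegral_pos_of_pos_on
  · exact (continuous_one_sub_sq_rpow hmu.le).intervalIntegrable _ _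
  · intro x hx
    exact Real.rpow_pos_of_pos (by nlinarith [hx.1, hx.2]) _
  · norm_num

/-! ### Dimensions of spherical harmonics and the norms of the polynomials -/

theorem mul_sphericalHarmonicDim {l : ℕ} (hl : 1 ≤ l) (n : ℕ) :
    (l : ℝ) * sphericalHarmonicDim (2 * l + 2) n = (n + l) * ((n + 2 * l - 1).choose n : ℝ) := by
  obtain ⟨m, rfl⟩ : ∃ m, l = m + 1 := ⟨l - 1, by omega⟩
  have h1 : (n + (2 * (m + 1) + 2) - 1) = n + (2 * m + 3) := by omega
  have h2 : (n + (2 * (m + 1) + 2) - 3) = n + (2 * m + 1) := by omega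
  have h3 : (n + 2 * (m + 1) - 1) = n + (2 * m + 1) := by omega
  rw [sphericalHarmonicDim, h1, h2, h3]
  rcases n with _ | _ | n
  · simp
  · simp; ring
  · have e : n + 1 + 1 - 2 = n := by omega
    rw [if_pos (by omega), e, Nat.cast_choose ℝ (show n + 1 + 1 ≤ n + 1 + 1 + (2 * m + 3) by omega),
      Nat.cast_choose ℝ (show n + 1 + 1 ≤ n + 1 + 1 + (2 * m + 1) by omega),
      Nat.cast_choose ℝ (show n ≤ n + 1 + 1 + (2 * m + 1) by omega),
      Nat.add_sub_cancel_left, Nat.add_sub_cancel_left,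
      show n + 1 + 1 + (2 * m + 1) - n = 2 * m + 3 by omega,
      show n + 1 + 1 + (2 * m + 3) = n + 1 + 1 + (2 * m + 1) + 1 + 1 by ring]
    simp only [Nat.factorial_succ (n + 1 + 1 + (2 * m + 1) + 1),
      Nat.factorial_succ (n + 1 + 1 + (2 * m + 1)), show 2 * m + 3 = 2 * m + 1 + 1 + 1 by ring,
      Nat.factorial_succ (2 * m + 1 + 1), Nat.factorial_succ (2 * m + 1),
      Nat.factorial_succ (n + 1), Nat.factorial_succ n]
    have := Nat.factorial_ne_zero (2 * m + 1)
    have := Nat.factorial_ne_zero n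
    push_cast
    field_simp
    ring

/-- The counterpart for dimensions of the recursion `gegenbauerInner_self_succ`: the factor `(n +
1)(n + 1 + 2l)` is common to both. -/
theorem sphericalHarmonicDim_succ {l : ℕ} (hl : 1 ≤ l) (n : ℕ) :
    (2 * (l + 1) * (2 * l + 1) : ℝ) * sphericalHarmonicDim (2 * (l + 1) + 2) n =
      (n + 1) * (n + 1 + 2 * l) * sphericalHarmonicDim (2 * l + 2) (n + 1) := by
  have h1 := mul_sphericalHarmonicDim hl (n + 1)
  have h2 := mul_sphericalHarmonicDim (show 1 ≤ l + 1 by omega) n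
  rw [show n + 1 + 2 * l - 1 = n + 2 * l by omega] at h1
  rw [show n + 2 * (l + 1) - 1 = n + 2 * l + 1 by omega] at h2
  have h3 : (2 * l + 1 : ℝ) * (2 * l) * ((n + 2 * l + 1).choose n : ℝ) =
      (n + 1) * (n + 1 + 2 * l) * ((n + 2 * l).choose (n + 1) : ℝ) := by
    obtain ⟨m, rfl⟩ : ∃ m, l = m + 1 := ⟨l - 1, by omega⟩
    rw [Nat.cast_choose ℝ (show n ≤ n + 2 * (m + 1) + 1 by omega),
      Nat.cast_choose ℝ (show n + 1 ≤ n + 2 * (m + 1) by omega),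
      show n + 2 * (m + 1) + 1 - n = 2 * m + 1 + 1 + 1 by omega,
      show n + 2 * (m + 1) - (n + 1) = 2 * m + 1 by omega,
      Nat.factorial_succ (2 * m + 1 + 1), Nat.factorial_succ (2 * m + 1),
      Nat.factorial_succ (n + 2 * (m + 1)), Nat.factorial_succ n]
    have := Nat.factorial_ne_zero (2 * m + 1)
    have := Nat.factorial_ne_zero n
    push_cast
    field_simp
    ring
  have hl0 : (l : ℝ) ≠ 0 := by positivity
  apply mul_left_cancel₀ hl0
  push_cast at h1 h2
  linear_combination (2 * l * (2 * l + 1)) * h2 - (n + 1) * (n + 1 + 2 * l) * h1 +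
    (n + 1 + l) * h3

/-- Both recursions trade `(l, n + 1)` for `(l + 1, n)`, and their ratio is exactly the one between
consecutive Beta integrals given by `tpsBeta_succ`. -/
theorem sphericalHarmonicDim_mul_gegenbauerInner_self {l : ℕ} (hl : 1 ≤ l) (n : ℕ) :
    sphericalHarmonicDim (2 * l + 2) n * gegenbauerInner l (gegenbauerW l n) (gegenbauerW l n) =
      tpsBeta ((l : ℝ) - 1 / 2) := by
  have hl' : (1 : ℝ) ≤ l := by exact_mod_cast hl
  induction n generalizing l with
  | zero =>
    rw [gegenbauerInner_self_eq, gegenbauerPoly_zero, tpsBeta]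
    simp [sphericalHarmonicDim]
  | succ n ih =>
    have h1 := ih (show 1 ≤ l + 1 by omega) (by push_cast; linarith)
    have h2 := sphericalHarmonicDim_succ hl n
    have h3 := tpsBeta_succ (mu := l - 1 / 2) (by linarith)
    rw [gegenbauerInner_self_succ hl']
    push_cast at h1
    rw [show (l : ℝ) + 1 - 1 / 2 = l - 1 / 2 + 1 by ring] at h1
    have hpos : (2 * l + 1 : ℝ) ^ 2 ≠ 0 := by positivity
    apply mul_left_cancel₀ hpos
    set I := gegenbauerInner ((l : ℝ) + 1) (gegenbauerW (l + 1) n) (gegenbauerW (l + 1) n)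
    have h4 := mul_div_cancel₀ ((n + 1 : ℝ) * (n + 1 + 2 * l)) hpos
    linear_combination sphericalHarmonicDim (2 * l + 2) (n + 1) * I * h4 - I * h2 +
      2 * (l + 1) * (2 * l + 1) * h1 + (2 * l + 1) * h3

theorem gegenbauerInner_self_ne_zero {l : ℕ} (hl : 1 ≤ l) (n : ℕ) :
    gegenbauerInner l (gegenbauerW l n) (gegenbauerW l n) ≠ 0 := by
  have hl' : (1 : ℝ) ≤ l := by exact_mod_cast hl
  have h := sphericalHarmonicDim_mul_gegenbauerInner_self hl n
  intro h0
  rw [h0, mul_zero] at h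
  exact (tpsBeta_pos (by linarith)).ne h

theorem gegenbauerCoeff_eq_iff {l : ℕ} (hl : 1 ≤ l) {f : ℝ → ℝ} {n : ℕ} {a : ℝ} :
    gegenbauerCoeff l f n = a * sphericalHarmonicDim (2 * l + 2) n ↔
      gegenbauerInner l f (gegenbauerW l n) = a * tpsBeta ((l : ℝ) - 1 / 2) := by
  rw [gegenbauerCoeff, div_eq_iff (gegenbauerInner_self_ne_zero hl n), mul_assoc,
    sphericalHarmonicDim_mul_gegenbauerInner_self hl n]

/-! ### The Beta integral in terms of the Gamma function -/

theorem tpsBeta_eq_Gamma {mu : ℝ} (hmu : -1 < mu) :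
    tpsBeta mu = Real.sqrt Real.pi * Real.Gamma (mu + 1) / Real.Gamma (mu + 3 / 2) := by
  have hb : ∫ u in (0 : ℝ)..1, u ^ mu * (1 - u) ^ mu =
      Real.Gamma (mu + 1) * Real.Gamma (mu + 1) / Real.Gamma (mu + 1 + (mu + 1)) := by
    have h := ProbabilityTheory.beta_eq_betaIntegralReal (mu + 1) (mu + 1) (by linarith)
      (by linarith)
    rw [ProbabilityTheory.beta] at h
    rw [h, Complex.betaIntegral]
    have e : ∫ x in (0 : ℝ)..1, (x : ℂ) ^ (((mu + 1 : ℝ) : ℂ) - 1) *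
        (1 - (x : ℂ)) ^ (((mu + 1 : ℝ) : ℂ) - 1) =
        ∫ x in (0 : ℝ)..1, ((x ^ mu * (1 - x) ^ mu : ℝ) : ℂ) := by
      apply intervalIntegral.integral_congr
      intro x hx
      rw [uIcc_of_le zero_le_one] at hx
      have e1 : ((mu + 1 : ℝ) : ℂ) - 1 = (mu : ℂ) := by push_cast; ring
      simp only [e1]
      rw [Complex.ofReal_mul, Complex.ofReal_cpow hx.1, Complex.ofReal_cpow (by linarith [hx.2])]
      push_cast
      rfl
    rw [e, intervalIntegral.integral_ofReal, Complex.ofReal_re]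
  -- Substituting `y = 2u - 1` gives the Euler integral `B(mu + 1, mu + 1)`; Legendre's duplication
  -- formula then removes `Γ(2mu + 2)`.
  have hsub : tpsBeta mu = 2 * (4 ^ mu * ∫ u in (0 : ℝ)..1, u ^ mu * (1 - u) ^ mu) := by
    rw [← intervalIntegral.integral_const_mul]
    have h := intervalIntegral.integral_comp_mul_add (a := 0) (b := 1)
      (fun y : ℝ => (1 - y ^ 2) ^ mu) (c := 2) (by norm_num) (-1)
    norm_num at h
    have e : ∫ u in (0 : ℝ)..1, 4 ^ mu * (u ^ mu * (1 - u) ^ mu) =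
        ∫ x in (0 : ℝ)..1, (1 - (2 * x + -1) ^ 2) ^ mu := by
      apply intervalIntegral.integral_congr
      intro x hx
      rw [uIcc_of_le zero_le_one] at hx
      simp only
      rw [show 1 - (2 * x + -1) ^ 2 = 4 * (x * (1 - x)) by ring,
        Real.mul_rpow (by norm_num) (mul_nonneg hx.1 (by linarith [hx.2])),
        Real.mul_rpow hx.1 (by linarith [hx.2])]
    rw [e, h, tpsBeta]
    ring
  rw [hsub, hb]
  have hd := Real.Gamma_mul_Gamma_add_half (mu + 1)
  have e1 : mu + 1 + 1 / 2 = mu + 3 / 2 := by ring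
  have e2 : (2 : ℝ) ^ (1 - 2 * (mu + 1)) = (2 * 4 ^ mu)⁻¹ := by
    rw [show (4 : ℝ) = 2 ^ (2 : ℝ) by norm_num, ← Real.rpow_mul (by norm_num),
      show 1 - 2 * (mu + 1) = -(1 + 2 * mu) by ring, Real.rpow_neg (by norm_num),
      Real.rpow_add (by norm_num), Real.rpow_one]
  rw [e1, e2] at hd
  rw [← two_mul]
  have h1 := (Real.Gamma_pos_of_pos (show 0 < mu + 1 by linarith)).ne'
  have h2 := (Real.Gamma_pos_of_pos (show 0 < mu + 3 / 2 by linarith)).ne'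
  have h3 := (Real.Gamma_pos_of_pos (show 0 < 2 * (mu + 1) by linarith)).ne'
  have h4 : (4 : ℝ) ^ mu ≠ 0 := by positivity
  generalize Real.Gamma (mu + 1) = a at *
  generalize Real.Gamma (mu + 3 / 2) = b at *
  generalize Real.Gamma (2 * (mu + 1)) = c at *
  field_simp at hd ⊢
  linear_combination hd

/-! ### Uniqueness: an expansion determines a continuous function -/

theorem MeasureTheory.IntegrableOn.mul_continuousOn_Ioo {f g : ℝ → ℝ} {a b : ℝ}
    (hf : IntegrableOn f (Ioo a b)) (hg : ContinuousOn g (Icc a b)) :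
    IntegrableOn (fun x => f x * g x) (Ioo a b) :=
  (((integrableOn_Icc_iff_integrableOn_Ioo (by simp) (by simp)).2 hf).mul_continuousOn hg
    isCompact_Icc).mono_set Ioo_subset_Icc_self

-- By Weierstrass, test functions are uniform limits of polynomials on `[a, b]`, and `g` is
-- integrable, so `g` annihilates every test function as well.
open Polynomial in
theorem ae_eq_zero_of_integral_mul_polynomial_eq_zero {g : ℝ → ℝ} {a b : ℝ}
    (hg : IntegrableOn g (Ioo a b)) (h : ∀ p : ℝ[X], ∫ x in Ioo a b, g x * p.eval x = 0) :
    ∀ᵐ x, x ∈ Ioo a b → g x = 0 := by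
  apply isOpen_Ioo.ae_eq_zero_of_integral_contDiff_smul_eq_zero hg.locallyIntegrableOn
  intro φ hφ _ hsupp
  have hφc : ContinuousOn φ (Icc a b) := hφ.continuous.continuousOn
  have hset : ∫ x, φ x • g x = ∫ x in Ioo a b, g x * φ x := by
    rw [← setIntegral_eq_integral_of_forall_compl_eq_zero (s := Ioo a b)]
    · simp only [smul_eq_mul, mul_comm]
    · intro x hx
      rw [image_eq_zero_of_notMem_tsupport fun hx' => hx (hsupp hx'), zero_smul]
  rw [hset]
  have hint : ∀ ψ : ℝ → ℝ, ContinuousOn ψ (Icc a b) →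
      IntegrableOn (fun x => g x * ψ x) (Ioo a b) :=
    fun ψ hψ => hg.mul_continuousOn_Ioo hψ
  set M := ∫ x in Ioo a b, |g x| with hM
  have hM0 : 0 ≤ M := integral_nonneg fun _ => abs_nonneg _
  have hle : ∀ ε > 0, |∫ x in Ioo a b, g x * φ x| ≤ ε * M := by
    intro ε hε
    obtain ⟨p, hp⟩ := exists_polynomial_near_of_continuousOn a b φ hφc ε hε
    have e : ∫ x in Ioo a b, g x * φ x = ∫ x in Ioo a b, g x * (φ x - p.eval x) := by
      simp only [mul_sub]
      rw [integral_sub (hint _ hφc) (hint _ p.continuous.continuousOn), h p, sub_zero]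
    rw [e, hM, ← integral_const_mul]
    refine (abs_integral_le_integral_abs).trans ?_
    apply setIntegral_mono_on (hint _ (hφc.sub p.continuous.continuousOn)).abs
      (hg.abs.const_mul ε) measurableSet_Ioo
    intro x hx
    have := hp x (Ioo_subset_Icc_self hx)
    rw [abs_sub_comm] at this
    rw [abs_mul, mul_comm]
    exact mul_le_mul_of_nonneg_right this.le (abs_nonneg _)
  by_contra hne
  have hpos := abs_pos.2 hne
  -- This `ε` makes `ε * M` smaller than the integral itself; `M + 1` covers the case `M = 0`.
  have := hle (|∫ x in Ioo a b, g x * φ x| / (2 * (M + 1))) (by positivity)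
  have h2 : |∫ x in Ioo a b, g x * φ x| / (2 * (M + 1)) * M <
      |∫ x in Ioo a b, g x * φ x| := by
    rw [div_mul_eq_mul_div, div_lt_iff₀ (by positivity)]
    nlinarith
  linarith

theorem eqOn_of_gegenbauerInner_eq {l : ℕ} {f g : ℝ → ℝ}
    (hf : ContinuousOn f (Ioo (-1 : ℝ) 1)) (hg : ContinuousOn g (Ioo (-1 : ℝ) 1))
    (hfi : IntegrableOn (fun x => f x * (1 - x ^ 2) ^ ((l : ℝ) - 1 / 2)) (Ioo (-1 : ℝ) 1))
    (hgi : IntegrableOn (fun x => g x * (1 - x ^ 2) ^ ((l : ℝ) - 1 / 2)) (Ioo (-1 : ℝ) 1))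
    (h : ∀ n, gegenbauerInner l f (gegenbauerW l n) = gegenbauerInner l g (gegenbauerW l n)) :
    EqOn f g (Ioo (-1 : ℝ) 1) := by
  set w : ℝ → ℝ := fun x => (1 - x ^ 2) ^ ((l : ℝ) - 1 / 2) with hw
  have hint : ∀ (u : ℝ → ℝ), IntegrableOn (fun x => u x * w x) (Ioo (-1 : ℝ) 1) →
      ∀ p : Polynomial ℝ, IntegrableOn (fun x => u x * w x * p.eval x) (Ioo (-1 : ℝ) 1) :=
    fun u hu p => hu.mul_continuousOn_Ioo p.continuous.continuousOn
  have hinner : ∀ (u : ℝ → ℝ) (n : ℕ), gegenbauerInner l u (gegenbauerW l n) =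
      ∫ x in Ioo (-1 : ℝ) 1, u x * w x * (gegenbauerPoly l n).eval x := by
    intro u n
    rw [gegenbauerInner, intervalIntegral.integral_of_le (by norm_num), integral_Ioc_eq_integral_Ioo]
    congr 1
    ext x
    rw [gegenbauerW_eq_eval]
    ring
  have hpoly : ∀ p : Polynomial ℝ,
      ∫ x in Ioo (-1 : ℝ) 1, (f x * w x - g x * w x) * p.eval x = 0 := by
    intro p
    have hp : p ∈ Submodule.span ℝ (range (gegenbauerPoly l)) := by
      rw [gegenbauerPoly_span (by positivity)]; trivial
    have hsub := fun p => (hint f hfi p).sub (hint g hgi p)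
    induction hp using Submodule.span_induction with
    | mem p hp =>
      obtain ⟨n, rfl⟩ := hp
      simp only [sub_mul]
      rw [integral_sub (hint f hfi _) (hint g hgi _), ← hinner, ← hinner, h n, sub_self]
    | zero => simp
    | add p q _ _ hp hq =>
      have : ∀ p : Polynomial ℝ, IntegrableOn
          (fun x => (f x * w x - g x * w x) * p.eval x) (Ioo (-1 : ℝ) 1) := by
        intro p
        simp only [sub_mul]
        exact hsub p
      simp only [Polynomial.eval_add, mul_add]
      rw [integral_add (this p) (this q), hp, hq, add_zero]
    | smul c p _ hp =>
      simp only [Polynomial.eval_smul, smul_eq_mul, mul_left_comm _ c]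
      rw [integral_const_mul, hp, mul_zero]
  have hae := ae_eq_zero_of_integral_mul_polynomial_eq_zero (hfi.sub hgi) hpoly
  have hae' : f =ᵐ[volume.restrict (Ioo (-1 : ℝ) 1)] g := by
    rw [Filter.EventuallyEq, ae_restrict_iff' measurableSet_Ioo]
    filter_upwards [hae] with x hx hxm
    have hpos : 0 < w x := Real.rpow_pos_of_pos (by nlinarith [hxm.1, hxm.2]) _
    have := hx hxm
    simp only [Pi.sub_apply] at this
    rw [← sub_mul] at this
    exact sub_eq_zero.1 ((mul_eq_zero.1 this).resolve_right hpos.ne')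
  exact Measure.eqOn_open_of_ae_eq hae' isOpen_Ioo hf hg

/-! ### The closed form, its weighted extension and its flux -/

/-- The closed form of the thinplate spline function on `(-1, 1)`. -/
noncomputable def tpsClosedForm (l : ℕ) (x : ℝ) : ℝ :=
  x * (Real.pi / 2 + Real.arcsin x) *
      (∑ j ∈ Finset.Icc 1 l, tpsC l j * (1 - x ^ 2) ^ (-(j : ℝ) + 1 / 2)) +
    (∑ j ∈ Finset.Icc 1 (l - 1), tpsD l j * (1 - x ^ 2) ^ (-(j : ℝ))) - tpsConst l

/-- The continuous extension to `[-1, 1]` of `tpsClosedForm l x * (1 - x ^ 2) ^ (l - 1 / 2)`. -/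
noncomputable def tpsWeighted (l : ℕ) (x : ℝ) : ℝ :=
  x * (Real.pi / 2 + Real.arcsin x) *
      (∑ j ∈ Finset.Icc 1 l, tpsC l j * (1 - x ^ 2) ^ ((l : ℝ) - j)) +
    (∑ j ∈ Finset.Icc 1 (l - 1), tpsD l j * (1 - x ^ 2) ^ ((l : ℝ) - j - 1 / 2)) -
    tpsConst l * (1 - x ^ 2) ^ ((l : ℝ) - 1 / 2)

/-- The coefficients of the reduction formula for `∫ (1 - x ^ 2) ^ (l - 1 / 2)`. -/
noncomputable def tpsG (l j : ℕ) : ℝ :=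
  (Nat.doubleFactorial (2 * l - 1) : ℝ) / (Nat.doubleFactorial (2 * l - 2 * j - 1) : ℝ) *
    ((Nat.doubleFactorial (2 * l - 2 * j - 2) : ℝ) / (Nat.doubleFactorial (2 * l) : ℝ))

/-- The primitive of `(1 - x ^ 2) ^ (l - 1 / 2)` vanishing at `-1`. -/
noncomputable def tpsFlux (l : ℕ) (x : ℝ) : ℝ :=
  tpsG l (l - 1) * (Real.pi / 2 + Real.arcsin x) +
    ∑ j ∈ Finset.range l, tpsG l j * (x * (1 - x ^ 2) ^ ((l : ℝ) - j - 1 / 2))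

theorem one_sub_sq_pos {x : ℝ} (hx : x ∈ Ioo (-1 : ℝ) 1) : 0 < 1 - x ^ 2 := by
  nlinarith [hx.1, hx.2]

theorem tpsClosedForm_mul_weight (l : ℕ) {x : ℝ} (hx : x ∈ Ioo (-1 : ℝ) 1) :
    tpsClosedForm l x * (1 - x ^ 2) ^ ((l : ℝ) - 1 / 2) = tpsWeighted l x := by
  have hs := one_sub_sq_pos hx
  have h1 : (∑ j ∈ Finset.Icc 1 l, tpsC l j * (1 - x ^ 2) ^ (-(j : ℝ) + 1 / 2)) *
      (1 - x ^ 2) ^ ((l : ℝ) - 1 / 2) =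
      ∑ j ∈ Finset.Icc 1 l, tpsC l j * (1 - x ^ 2) ^ ((l : ℝ) - j) := by
    rw [Finset.sum_mul]
    refine Finset.sum_congr rfl fun j _ => ?_
    rw [mul_assoc, ← Real.rpow_add hs,
      show -(j : ℝ) + 1 / 2 + (l - 1 / 2) = l - j by ring]
  have h2 : (∑ j ∈ Finset.Icc 1 (l - 1), tpsD l j * (1 - x ^ 2) ^ (-(j : ℝ))) *
      (1 - x ^ 2) ^ ((l : ℝ) - 1 / 2) =
      ∑ j ∈ Finset.Icc 1 (l - 1), tpsD l j * (1 - x ^ 2) ^ ((l : ℝ) - j - 1 / 2) := by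
    rw [Finset.sum_mul]
    refine Finset.sum_congr rfl fun j _ => ?_
    rw [mul_assoc, ← Real.rpow_add hs, show -(j : ℝ) + (l - 1 / 2) = l - j - 1 / 2 by ring]
  rw [tpsClosedForm, tpsWeighted, ← h1, ← h2]
  ring

theorem continuous_tpsWeighted {l : ℕ} (hl : 1 ≤ l) : Continuous (tpsWeighted l) := by
  have hl' : (1 : ℝ) ≤ l := by exact_mod_cast hl
  refine ((((continuous_id.mul (continuous_const.add Real.continuous_arcsin)).mul
    (continuous_finsetSum _ fun j hj => ?_)).add (continuous_finsetSum _ fun j hj => ?_)).sub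
    ((continuous_one_sub_sq_rpow (by linarith)).const_mul _))
  · have : (j : ℝ) ≤ l := by exact_mod_cast (Finset.mem_Icc.1 hj).2
    exact (continuous_one_sub_sq_rpow (by linarith)).const_mul _
  · have : (j : ℝ) + 1 ≤ l := by
      have := (Finset.mem_Icc.1 hj).2
      exact_mod_cast (by omega : j + 1 ≤ l)
    exact (continuous_one_sub_sq_rpow (by linarith)).const_mul _

theorem hasDerivAt_mul_one_sub_sq_rpow {p x : ℝ} (hx : x ∈ Ioo (-1 : ℝ) 1) :
    HasDerivAt (fun y : ℝ => y * (1 - y ^ 2) ^ p)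
      ((2 * p + 1) * (1 - x ^ 2) ^ p - 2 * p * (1 - x ^ 2) ^ (p - 1)) x := by
  have hs := one_sub_sq_pos hx
  refine ((hasDerivAt_id' x).fun_mul
    (hasDerivAt_one_sub_sq_rpow (p := p) (Or.inl hs.ne'))).congr_deriv ?_
  have h : (1 - x ^ 2) ^ p = (1 - x ^ 2) * (1 - x ^ 2) ^ (p - 1) := by
    rw [Real.rpow_sub_one hs.ne', mul_div_cancel₀ _ hs.ne']
  rw [h]
  ring

theorem hasDerivAt_pi_div_two_add_arcsin {x : ℝ} (hx : x ∈ Ioo (-1 : ℝ) 1) :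
    HasDerivAt (fun y : ℝ => Real.pi / 2 + Real.arcsin y) ((1 - x ^ 2) ^ (-(1 / 2 : ℝ))) x := by
  refine ((Real.hasDerivAt_arcsin hx.1.ne' hx.2.ne).const_add _).congr_deriv ?_
  rw [Real.sqrt_eq_rpow, Real.rpow_neg (one_sub_sq_pos hx).le, one_div]

theorem tpsC_succ {l j : ℕ} (hj : 1 ≤ j) :
    2 * (j : ℝ) * tpsC l (j + 1) = (2 * (j : ℝ) - 1) * tpsC l j := by
  obtain ⟨i, rfl⟩ : ∃ i, j = i + 1 := ⟨j - 1, by omega⟩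
  rw [tpsC, tpsC, show 2 * (i + 1 + 1) - 1 = 2 * i + 1 + 2 by omega,
    show 2 * (i + 1 + 1) - 2 = 2 * i + 2 by omega, show 2 * (i + 1) - 1 = 2 * i + 1 by omega,
    show 2 * (i + 1) - 2 = 2 * i by omega, Nat.doubleFactorial_add_two, Nat.doubleFactorial_add_two]
  have h1 := (Nat.doubleFactorial_pos (2 * i)).ne'
  have h2 : 2 * ((i + 1 : ℕ) : ℝ) - 1 = 2 * i + 1 := by push_cast; ring
  have h3 : 2 * ((i + 1 + 1 : ℕ) : ℝ) - 1 = 2 * i + 3 := by push_cast; ring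
  rw [h2, h3]
  push_cast
  field_simp
  ring

theorem tpsG_zero {l : ℕ} (hl : 1 ≤ l) : 2 * (l : ℝ) * tpsG l 0 = 1 := by
  obtain ⟨m, rfl⟩ : ∃ m, l = m + 1 := ⟨l - 1, by omega⟩
  rw [tpsG, show 2 * (m + 1) - 2 * 0 - 1 = 2 * m + 1 by omega,
    show 2 * (m + 1) - 2 * 0 - 2 = 2 * m by omega, show 2 * (m + 1) - 1 = 2 * m + 1 by omega,
    show 2 * (m + 1) = 2 * m + 2 by ring, Nat.doubleFactorial_add_two]
  have h1 := (Nat.doubleFactorial_pos (2 * m)).ne'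
  have h2 := (Nat.doubleFactorial_pos (2 * m + 1)).ne'
  push_cast
  field_simp

theorem tpsG_succ {l j : ℕ} (hj : j + 1 < l) :
    (2 * ((l : ℝ) - j) - 1) * tpsG l j = (2 * ((l : ℝ) - j) - 2) * tpsG l (j + 1) := by
  obtain ⟨k, rfl⟩ : ∃ k, l = j + 2 + k := ⟨l - (j + 2), by omega⟩
  rw [tpsG, tpsG, show 2 * (j + 2 + k) - 2 * j - 1 = 2 * k + 1 + 2 by omega,
    show 2 * (j + 2 + k) - 2 * j - 2 = 2 * k + 2 by omega,
    show 2 * (j + 2 + k) - 2 * (j + 1) - 1 = 2 * k + 1 by omega,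
    show 2 * (j + 2 + k) - 2 * (j + 1) - 2 = 2 * k by omega,
    Nat.doubleFactorial_add_two (2 * k + 1), Nat.doubleFactorial_add_two (2 * k)]
  have h1 := (Nat.doubleFactorial_pos (2 * k + 1)).ne'
  have h2 := (Nat.doubleFactorial_pos (2 * (j + 2 + k))).ne'
  push_cast
  field_simp
  ring

theorem tpsC_last {l : ℕ} (hl : 1 ≤ l) : (2 * (l : ℝ) - 1) * tpsC l l = tpsG l (l - 1) := by
  obtain ⟨m, rfl⟩ : ∃ m, l = m + 1 := ⟨l - 1, by omega⟩
  rw [tpsG, tpsC, show 2 * (m + 1) - 2 * (m + 1 - 1) - 1 = 1 by omega,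
    show 2 * (m + 1) - 2 * (m + 1 - 1) - 2 = 0 by omega, show 2 * (m + 1) - 1 = 2 * m + 1 by omega,
    show 2 * (m + 1) - 2 = 2 * m by omega,
    show 2 * (m + 1) = 2 * m + 2 by ring, Nat.doubleFactorial_add_two]
  have h1 := (Nat.doubleFactorial_pos (2 * m)).ne'
  have h2 : 2 * ((m + 1 : ℕ) : ℝ) - 1 = 2 * m + 1 := by push_cast; ring
  rw [h2]
  simp only [Nat.doubleFactorial]
  push_cast
  field_simp

theorem tpsC_one {l : ℕ} (hl : 1 ≤ l) : tpsC l 1 = tpsG l 0 := by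
  have h := tpsG_zero hl
  have hl' : (l : ℝ) ≠ 0 := by positivity
  have : tpsC l 1 = 1 / (2 * l) := by norm_num [tpsC, Nat.doubleFactorial]
  rw [this]
  field_simp
  linear_combination -h

/-- The origin of `d_j`: it supplies the part of the flux coefficient `tpsG l j` that
differentiating `arcsin` against the `c`-sum leaves missing. -/
theorem tpsD_add_tpsC {l j : ℕ} (hj : 1 ≤ j) :
    2 * (j : ℝ) * tpsD l j + tpsC l (j + 1) = tpsG l j := by
  rw [tpsC, tpsD, tpsG, show 2 * (j + 1) - 1 = 2 * j - 1 + 2 by omega,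
    show 2 * (j + 1) - 2 = 2 * j by omega, Nat.doubleFactorial_add_two]
  have h1 := (Nat.doubleFactorial_pos (2 * j)).ne'
  have h2 : 2 * ((j + 1 : ℕ) : ℝ) - 1 = 2 * j + 1 := by push_cast; ring
  have h3 : ((2 * j - 1 + 2 : ℕ) : ℝ) = 2 * j + 1 := by
    rw [show 2 * j - 1 + 2 = 2 * j + 1 by omega]; push_cast; ring
  have h4 : (j : ℝ) ≠ 0 := by positivity
  have h5 : 2 * (j : ℝ) + 1 ≠ 0 := by positivity
  rw [h2, Nat.cast_mul, h3, ← mul_assoc, mul_one_div_cancel (by positivity)]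
  field_simp
  ring

theorem sum_tpsC_add_sum_tpsD {l : ℕ} (hl : 1 ≤ l) (φ : ℕ → ℝ) :
    ∑ j ∈ Finset.Icc 1 l, tpsC l j * φ j +
        ∑ j ∈ Finset.Icc 1 (l - 1), 2 * (j : ℝ) * tpsD l j * φ (j + 1) =
      ∑ j ∈ Finset.range l, tpsG l j * φ (j + 1) := by
  have hshift : ∀ (m : ℕ) (f : ℕ → ℝ),
      ∑ j ∈ Finset.Icc 1 m, f j = ∑ j ∈ Finset.range m, f (j + 1) := by
    intro m f
    rw [Finset.range_eq_Ico, Finset.sum_Ico_add' f 0 m 1]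
    rfl
  obtain ⟨m, rfl⟩ : ∃ m, l = m + 1 := ⟨l - 1, by omega⟩
  rw [hshift, hshift, Nat.add_sub_cancel, Finset.sum_range_succ', Finset.sum_range_succ',
    add_right_comm, ← Finset.sum_add_distrib, tpsC_one hl]
  congr 1
  refine Finset.sum_congr rfl fun j _ => ?_
  rw [← tpsD_add_tpsC (by omega)]
  ring

/-- Term `j` equals `c_j ((2 - 2j) s^(-j + 1/2) + (2j - 1) s^(-j - 1/2))`. By `tpsC_succ`
neighbouring terms cancel, and the first power has coefficient zero at `j = 1`. -/
theorem sum_tpsC_telescope {l m : ℕ} (hm : 1 ≤ m) (s : ℝ) :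
    ∑ j ∈ Finset.Icc 1 m, tpsC l j * ((2 * (-(j : ℝ) + 1 / 2) + 1) * s ^ (-(j : ℝ) + 1 / 2) -
        2 * (-(j : ℝ) + 1 / 2) * s ^ (-(j : ℝ) + 1 / 2 - 1)) =
      (2 * (m : ℝ) - 1) * tpsC l m * s ^ (-(m : ℝ) - 1 / 2) := by
  induction m, hm using Nat.le_induction with
  | base => norm_num
  | succ m hm ih =>
    rw [Finset.sum_Icc_succ_top (by omega), ih,
      show -((m + 1 : ℕ) : ℝ) + 1 / 2 = -m - 1 / 2 by push_cast; ring,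
      show -((m + 1 : ℕ) : ℝ) - 1 / 2 = -m - 1 / 2 - 1 by push_cast; ring]
    push_cast
    linear_combination (-s ^ (-(m : ℝ) - 1 / 2)) * tpsC_succ (l := l) hm

/-- The iterated reduction formula for the integral of the weight. At `m = l - 1` the remainder is a
multiple of `s^(-1/2)`, which the derivative of the `arcsin` term cancels. -/
theorem sum_tpsG_telescope {l m : ℕ} (hm : m + 1 ≤ l) {s : ℝ} :
    ∑ j ∈ Finset.range (m + 1), tpsG l j *
        ((2 * ((l : ℝ) - j - 1 / 2) + 1) * s ^ ((l : ℝ) - j - 1 / 2) -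
          2 * ((l : ℝ) - j - 1 / 2) * s ^ ((l : ℝ) - j - 1 / 2 - 1)) =
      s ^ ((l : ℝ) - 1 / 2) -
        (2 * ((l : ℝ) - m) - 1) * tpsG l m * s ^ ((l : ℝ) - m - 1 / 2 - 1) := by
  induction m with
  | zero =>
    have h := tpsG_zero hm
    simp only [zero_add, Finset.sum_range_one, Nat.cast_zero, sub_zero]
    linear_combination s ^ ((l : ℝ) - 1 / 2) * h
  | succ m ih =>
    rw [Finset.sum_range_succ, ih (by omega), tpsG_succ (by omega)]
    push_cast
    rw [show (l : ℝ) - (m + 1) - 1 / 2 = l - m - 1 / 2 - 1 by ring]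
    ring

theorem hasDerivAt_tpsFlux {l : ℕ} (hl : 1 ≤ l) {x : ℝ} (hx : x ∈ Ioo (-1 : ℝ) 1) :
    HasDerivAt (tpsFlux l) ((1 - x ^ 2) ^ ((l : ℝ) - 1 / 2)) x := by
  refine (((hasDerivAt_pi_div_two_add_arcsin hx).const_mul _).fun_add
    (HasDerivAt.fun_sum fun j _ => (hasDerivAt_mul_one_sub_sq_rpow hx).const_mul _)).congr_deriv ?_
  obtain ⟨m, rfl⟩ : ∃ m, l = m + 1 := ⟨l - 1, by omega⟩
  rw [sum_tpsG_telescope le_rfl, Nat.add_sub_cancel]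
  push_cast
  rw [show (m : ℝ) + 1 - m - 1 / 2 - 1 = -(1 / 2) by ring]
  ring

theorem continuous_tpsFlux (l : ℕ) : Continuous (tpsFlux l) := by
  refine ((continuous_const.add Real.continuous_arcsin).const_mul _).add
    (continuous_finsetSum _ fun j hj => ?_)
  have : (j : ℝ) + 1 ≤ l := by exact_mod_cast Finset.mem_range.1 hj
  exact (continuous_id.mul (continuous_one_sub_sq_rpow (by linarith))).const_mul _

theorem tpsFlux_neg_one (l : ℕ) : tpsFlux l (-1) = 0 := by
  rw [tpsFlux, Real.arcsin_neg_one, add_neg_cancel, mul_zero, zero_add]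
  refine Finset.sum_eq_zero fun j hj => ?_
  have : (j : ℝ) + 1 ≤ l := by exact_mod_cast Finset.mem_range.1 hj
  rw [one_sub_sq_rpow_neg_one (by linarith), mul_zero, mul_zero]

theorem tpsFlux_eq_integral {l : ℕ} (hl : 1 ≤ l) {x : ℝ} (hx : x ∈ Icc (-1 : ℝ) 1) :
    tpsFlux l x = ∫ y in (-1 : ℝ)..x, (1 - y ^ 2) ^ ((l : ℝ) - 1 / 2) := by
  have hl' : (1 : ℝ) ≤ l := by exact_mod_cast hl
  rw [intervalIntegral.integral_eq_sub_of_hasDerivAt_of_le hx.1 (continuous_tpsFlux l).continuousOn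
    (fun y hy => hasDerivAt_tpsFlux hl ⟨hy.1, hy.2.trans_le hx.2⟩)
    ((continuous_one_sub_sq_rpow (by linarith)).intervalIntegrable _ _), tpsFlux_neg_one, sub_zero]

theorem tpsFlux_one {l : ℕ} (hl : 1 ≤ l) : tpsFlux l 1 = tpsBeta ((l : ℝ) - 1 / 2) :=
  tpsFlux_eq_integral hl (by norm_num)

/-- The Green's function property. The part of the derivative carrying `π/2 + arcsin` telescopes to
its top term; the rest matches the algebraic part of the flux power by power. -/
theorem hasDerivAt_tpsClosedForm {l : ℕ} (hl : 1 ≤ l) {x : ℝ} (hx : x ∈ Ioo (-1 : ℝ) 1) :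
    HasDerivAt (tpsClosedForm l) (tpsFlux l x * (1 - x ^ 2) ^ (-((l : ℝ) + 1 / 2))) x := by
  have hs := one_sub_sq_pos hx
  have hd : HasDerivAt (fun y => (Real.pi / 2 + Real.arcsin y) *
        ∑ j ∈ Finset.Icc 1 l, tpsC l j * (y * (1 - y ^ 2) ^ (-(j : ℝ) + 1 / 2)) +
      ∑ j ∈ Finset.Icc 1 (l - 1), tpsD l j * (1 - y ^ 2) ^ (-(j : ℝ)) - tpsConst l) _ x :=
    (((hasDerivAt_pi_div_two_add_arcsin hx).fun_mul (HasDerivAt.fun_sum fun j _ =>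
      (hasDerivAt_mul_one_sub_sq_rpow hx).const_mul _)).fun_add (HasDerivAt.fun_sum fun j _ =>
      (hasDerivAt_one_sub_sq_rpow (Or.inl hs.ne')).const_mul _)).sub_const _
  have hfun : tpsClosedForm l = fun y => (Real.pi / 2 + Real.arcsin y) *
        ∑ j ∈ Finset.Icc 1 l, tpsC l j * (y * (1 - y ^ 2) ^ (-(j : ℝ) + 1 / 2)) +
      ∑ j ∈ Finset.Icc 1 (l - 1), tpsD l j * (1 - y ^ 2) ^ (-(j : ℝ)) - tpsConst l := by
    ext y
    simp only [tpsClosedForm, mul_left_comm _ y, ← Finset.mul_sum]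
    ring
  rw [hfun]
  refine hd.congr_deriv ?_
  rw [sum_tpsC_telescope hl, tpsC_last hl]
  have hsum := sum_tpsC_add_sum_tpsD hl (fun j => x * (1 - x ^ 2) ^ (-(j : ℝ)))
  have e1 : (1 - x ^ 2) ^ (-(1 / 2 : ℝ)) *
      ∑ j ∈ Finset.Icc 1 l, tpsC l j * (x * (1 - x ^ 2) ^ (-(j : ℝ) + 1 / 2)) =
      ∑ j ∈ Finset.Icc 1 l, tpsC l j * (x * (1 - x ^ 2) ^ (-(j : ℝ))) := by
    rw [Finset.mul_sum]
    refine Finset.sum_congr rfl fun j _ => ?_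
    have h := Real.rpow_add hs (-(1 / 2)) (-(j : ℝ) + 1 / 2)
    rw [show -(1 / 2) + (-(j : ℝ) + 1 / 2) = -j by ring] at h
    rw [h]
    ring
  have e2 : ∑ j ∈ Finset.Icc 1 (l - 1),
      tpsD l j * (-(2 * -(j : ℝ)) * x * (1 - x ^ 2) ^ (-(j : ℝ) - 1)) =
      ∑ j ∈ Finset.Icc 1 (l - 1), 2 * (j : ℝ) * tpsD l j *
        (x * (1 - x ^ 2) ^ (-((j + 1 : ℕ) : ℝ))) := by
    refine Finset.sum_congr rfl fun j _ => ?_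
    rw [show -((j + 1 : ℕ) : ℝ) = -(j : ℝ) - 1 by push_cast; ring]
    ring
  have e3 : (∑ j ∈ Finset.range l, tpsG l j * (x * (1 - x ^ 2) ^ ((l : ℝ) - j - 1 / 2))) *
      (1 - x ^ 2) ^ (-((l : ℝ) + 1 / 2)) =
      ∑ j ∈ Finset.range l, tpsG l j * (x * (1 - x ^ 2) ^ (-((j + 1 : ℕ) : ℝ))) := by
    rw [Finset.sum_mul]
    refine Finset.sum_congr rfl fun j _ => ?_
    rw [show -((j + 1 : ℕ) : ℝ) = (l - j - 1 / 2) + -((l : ℝ) + 1 / 2) by push_cast; ring,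
      Real.rpow_add hs]
    ring
  rw [e1, e2, tpsFlux, add_mul (tpsG _ _ * _), e3, ← hsum, show -(l : ℝ) - 1 / 2 = -(l + 1 / 2) by ring]
  ring

/-! ### Fourier–Gegenbauer coefficients of the closed form -/

theorem integral_tpsWeighted_mul_gegenbauerPoly {l : ℕ} (hl : 1 ≤ l) (n : ℕ) :
    (n * (n + 2 * l) : ℝ) *
        (∫ x in (-1 : ℝ)..1, tpsWeighted l x * (gegenbauerPoly l n).eval x) +
      ∫ x in (-1 : ℝ)..1, (gegenbauerPoly l n).eval x * (1 - x ^ 2) ^ ((l : ℝ) - 1 / 2) =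
    tpsBeta ((l : ℝ) - 1 / 2) := by
  have hl' : (1 : ℝ) ≤ l := by exact_mod_cast hl
  set P := gegenbauerPoly l n with hP
  have hc1 : Continuous fun x => tpsWeighted l x * P.eval x :=
    (continuous_tpsWeighted hl).mul P.continuous
  have hc2 := continuous_polynomial_mul_weight hl' P
  have h := intervalIntegral.integral_eq_sub_of_hasDerivAt_of_le (a := -1) (b := 1)
    -- On the open interval this is `K (1 - x²)^(l + 1/2) P' - Φ P`. Written with `tpsWeighted` it
    -- is continuous on `[-1, 1]`, and its first term visibly vanishes at both ends.
    (f := fun x => (1 - x ^ 2) * tpsWeighted l x * (Polynomial.derivative P).eval x -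
      tpsFlux l x * P.eval x)
    (f' := fun x => -(n * (n + 2 * l) : ℝ) * (tpsWeighted l x * P.eval x) -
      P.eval x * (1 - x ^ 2) ^ ((l : ℝ) - 1 / 2)) (by norm_num) ?_ (fun x hx => ?_)
    (((hc1.const_mul _).sub hc2).intervalIntegrable _ _)
  · rw [intervalIntegral.integral_sub ((hc1.const_mul _).intervalIntegrable _ _)
      (hc2.intervalIntegrable _ _), intervalIntegral.integral_const_mul, tpsFlux_one hl,
      tpsFlux_neg_one, hP, gegenbauerPoly_eval_one] at h
    linear_combination -h
  · have h1 := continuous_tpsWeighted hl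
    have h2 := continuous_tpsFlux l
    have h3 := P.continuous
    have h4 := (Polynomial.derivative P).continuous
    fun_prop
  · have hs := one_sub_sq_pos hx
    have hw := gegenbauerPoly_hasDerivAt_weighted hl' n (Ioo_subset_Icc_self hx)
    have hd := ((hasDerivAt_tpsClosedForm hl hx).fun_mul hw).fun_sub
      ((hasDerivAt_tpsFlux hl hx).fun_mul (P.hasDerivAt x))
    refine (hd.congr_of_eventuallyEq ?_).congr_deriv ?_
    · filter_upwards [isOpen_Ioo.mem_nhds hx] with y hy
      rw [← tpsClosedForm_mul_weight l hy, show (l : ℝ) + 1 / 2 = l - 1 / 2 + 1 by ring,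
        one_sub_sq_rpow_eq_mul (Ioo_subset_Icc_self hy) (by linarith)]
      ring
    · rw [← tpsClosedForm_mul_weight l hx, ← hP, Real.rpow_neg hs.le]
      have := (Real.rpow_pos_of_pos hs ((l : ℝ) + 1 / 2)).ne'
      field_simp
      ring

theorem integral_tpsWeighted {l : ℕ} (hl : 1 ≤ l) :
    ∫ x in (-1 : ℝ)..1, tpsWeighted l x = 0 := by
  have hl' : (1 : ℝ) ≤ l := by exact_mod_cast hl
  have hj1 : ∀ j ∈ Finset.Icc 1 l, (j : ℝ) ≤ l := fun j hj => by
    exact_mod_cast (Finset.mem_Icc.1 hj).2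
  have hj2 : ∀ j ∈ Finset.Icc 1 (l - 1), (j : ℝ) + 1 ≤ l := fun j hj => by
    have := (Finset.mem_Icc.1 hj).2
    exact_mod_cast (by omega : j + 1 ≤ l)
  have hcont : ∀ p : ℝ, 0 ≤ p → Continuous fun y : ℝ => (1 - y ^ 2) ^ p := fun p hp =>
    continuous_one_sub_sq_rpow hp
  have hcC : Continuous fun x : ℝ => ∑ j ∈ Finset.Icc 1 l,
      1 / (2 * ((l : ℝ) - j + 1)) * tpsC l j * (1 - x ^ 2) ^ ((l : ℝ) - j + 1 / 2) :=
    continuous_finsetSum _ fun j hj => (hcont _ (by linarith [hj1 j hj])).const_mul _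
  have hcD : Continuous fun x : ℝ => ∑ j ∈ Finset.Icc 1 (l - 1),
      tpsD l j * (1 - x ^ 2) ^ ((l : ℝ) - j - 1 / 2) :=
    continuous_finsetSum _ fun j hj => (hcont _ (by linarith [hj2 j hj])).const_mul _
  have hcW : Continuous fun x : ℝ => tpsConst l * (1 - x ^ 2) ^ ((l : ℝ) - 1 / 2) :=
    (hcont _ (by linarith)).const_mul _
  have hcE : Continuous fun x : ℝ => ∑ j ∈ Finset.Icc 1 l,
      1 / (2 * ((l : ℝ) - j + 1)) * tpsC l j * (1 - x ^ 2) ^ ((l : ℝ) - j + 1) :=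
    continuous_finsetSum _ fun j hj => (hcont _ (by linarith [hj1 j hj])).const_mul _
  have hcT := continuous_tpsWeighted hl
  have hCint : ∫ x in (-1 : ℝ)..1, (∑ j ∈ Finset.Icc 1 l,
      1 / (2 * ((l : ℝ) - j + 1)) * tpsC l j * (1 - x ^ 2) ^ ((l : ℝ) - j + 1 / 2)) =
      ∑ j ∈ Finset.Icc 1 l,
        1 / (2 * ((l : ℝ) - j + 1)) * tpsC l j * tpsBeta ((l : ℝ) - j + 1 / 2) := by
    rw [intervalIntegral.integral_finsetSum fun j hj =>
      ((hcont _ (by linarith [hj1 j hj])).const_mul _).intervalIntegrable _ _]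
    simp only [intervalIntegral.integral_const_mul, tpsBeta]
  have hDint : ∫ x in (-1 : ℝ)..1, (∑ j ∈ Finset.Icc 1 (l - 1),
      tpsD l j * (1 - x ^ 2) ^ ((l : ℝ) - j - 1 / 2)) =
      ∑ j ∈ Finset.Icc 1 (l - 1), tpsD l j * tpsBeta ((l : ℝ) - j - 1 / 2) := by
    rw [intervalIntegral.integral_finsetSum fun j hj =>
      ((hcont _ (by linarith [hj2 j hj])).const_mul _).intervalIntegrable _ _]
    simp only [intervalIntegral.integral_const_mul, tpsBeta]
  have hE : ∀ x : ℝ, 1 - x ^ 2 = 0 → ∑ j ∈ Finset.Icc 1 l,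
      1 / (2 * ((l : ℝ) - j + 1)) * tpsC l j * (1 - x ^ 2) ^ ((l : ℝ) - j + 1) = 0 := by
    refine fun x hx => Finset.sum_eq_zero fun j hj => ?_
    rw [hx, Real.zero_rpow (by linarith [hj1 j hj]), mul_zero]
  have h := intervalIntegral.integral_eq_sub_of_hasDerivAt_of_le (a := -1) (b := 1)
    -- Integration by parts on `x v (1 - x²)^(l - j)`: integrating `x (1 - x²)^(l - j)` produces the
    -- factor `1 / (2(l - j + 1))` of `tpsConst`, and `v' = (1 - x²)^(-1/2)` raises the remaining
    -- exponent to `l - j + 1/2`.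
    (f := fun x => -((Real.pi / 2 + Real.arcsin x) * ∑ j ∈ Finset.Icc 1 l,
      1 / (2 * ((l : ℝ) - j + 1)) * tpsC l j * (1 - x ^ 2) ^ ((l : ℝ) - j + 1)))
    (f' := fun x => tpsWeighted l x - (∑ j ∈ Finset.Icc 1 l,
      1 / (2 * ((l : ℝ) - j + 1)) * tpsC l j * (1 - x ^ 2) ^ ((l : ℝ) - j + 1 / 2)) -
      (∑ j ∈ Finset.Icc 1 (l - 1), tpsD l j * (1 - x ^ 2) ^ ((l : ℝ) - j - 1 / 2)) +
      tpsConst l * (1 - x ^ 2) ^ ((l : ℝ) - 1 / 2)) (by norm_num) ?_ (fun x hx => ?_)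
    ((((hcT.sub hcC).sub hcD).add hcW).intervalIntegrable _ _)
  · rw [intervalIntegral.integral_add (((hcT.fun_sub hcC).fun_sub hcD).intervalIntegrable _ _)
      (hcW.intervalIntegrable _ _), intervalIntegral.integral_sub
      ((hcT.fun_sub hcC).intervalIntegrable _ _) (hcD.intervalIntegrable _ _),
      intervalIntegral.integral_sub (hcT.intervalIntegrable _ _) (hcC.intervalIntegrable _ _),
      hCint, hDint, intervalIntegral.integral_const_mul, hE 1 (by norm_num), hE (-1) (by norm_num),
      ← tpsBeta, tpsConst] at h
    have hb := (tpsBeta_pos (mu := l - 1 / 2) (by linarith)).ne'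
    rw [one_div_mul_eq_div, div_mul_cancel₀ _ hb] at h
    linear_combination h
  · have := Real.continuous_arcsin
    fun_prop
  · have hs := one_sub_sq_pos hx
    refine ((hasDerivAt_pi_div_two_add_arcsin hx).fun_mul (HasDerivAt.fun_sum fun j _ =>
      (hasDerivAt_one_sub_sq_rpow (Or.inl hs.ne')).const_mul _)).fun_neg.congr_deriv ?_
    have e1 : (1 - x ^ 2) ^ (-(1 / 2 : ℝ)) * ∑ j ∈ Finset.Icc 1 l,
        1 / (2 * ((l : ℝ) - j + 1)) * tpsC l j * (1 - x ^ 2) ^ ((l : ℝ) - j + 1) =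
        ∑ j ∈ Finset.Icc 1 l,
          1 / (2 * ((l : ℝ) - j + 1)) * tpsC l j * (1 - x ^ 2) ^ ((l : ℝ) - j + 1 / 2) := by
      rw [Finset.mul_sum]
      refine Finset.sum_congr rfl fun j _ => ?_
      have h := Real.rpow_add hs (-(1 / 2)) ((l : ℝ) - j + 1)
      rw [show -(1 / 2) + ((l : ℝ) - j + 1) = l - j + 1 / 2 by ring] at h
      rw [h]
      ring
    have e2 : ∑ j ∈ Finset.Icc 1 l, 1 / (2 * ((l : ℝ) - j + 1)) * tpsC l j *
        (-(2 * ((l : ℝ) - j + 1)) * x * (1 - x ^ 2) ^ ((l : ℝ) - j + 1 - 1)) =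
        -x * ∑ j ∈ Finset.Icc 1 l, tpsC l j * (1 - x ^ 2) ^ ((l : ℝ) - j) := by
      rw [Finset.mul_sum]
      refine Finset.sum_congr rfl fun j hj => ?_
      have : (l : ℝ) - j + 1 ≠ 0 := by linarith [hj1 j hj]
      rw [add_sub_cancel_right]
      field_simp
    rw [e1, e2, tpsWeighted]
    ring

theorem gegenbauerInner_eq_of_eqOn_tpsClosedForm {l : ℕ} {k : ℝ → ℝ}
    (hk : EqOn k (tpsClosedForm l) (Ioo (-1 : ℝ) 1)) (n : ℕ) :
    gegenbauerInner l k (gegenbauerW l n) =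
      ∫ x in (-1 : ℝ)..1, tpsWeighted l x * (gegenbauerPoly l n).eval x := by
  rw [gegenbauerInner, intervalIntegral.integral_of_le (by norm_num),
    intervalIntegral.integral_of_le (by norm_num), integral_Ioc_eq_integral_Ioo,
    integral_Ioc_eq_integral_Ioo]
  refine setIntegral_congr_fun measurableSet_Ioo fun x hx => ?_
  simp only [hk hx, gegenbauerW_eq_eval, ← tpsClosedForm_mul_weight l hx]
  ring

theorem isThinplateSplineFunction_one_iff {l : ℕ} (hl : 1 ≤ l) {k : ℝ → ℝ} :
    IsThinplateSplineFunction (2 * l + 2) 1 k ↔ ContinuousOn k (Ico (-1 : ℝ) 1) ∧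
      IntegrableOn (fun x => k x * (1 - x ^ 2) ^ ((l : ℝ) - 1 / 2)) (Ioo (-1 : ℝ) 1) ∧
      ∀ n : ℕ, gegenbauerInner l k (gegenbauerW l n) =
        (if n = 0 then 0 else ((n : ℝ) * (n + 2 * l))⁻¹) * tpsBeta ((l : ℝ) - 1 / 2) := by
  have e : (((2 * l + 2 : ℕ) : ℝ) - 2) / 2 = l := by push_cast; ring
  rw [IsThinplateSplineFunction, HasGegenbauerExpansion, e]
  refine and_congr_right fun _ => and_congr_right fun _ => forall_congr' fun n => ?_
  rw [← gegenbauerCoeff_eq_iff hl]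
  split_ifs with hn
  · rw [zero_mul]
  · push_cast
    rw [pow_one, ← add_sub, add_sub_cancel_right]

theorem integrableOn_of_eqOn_tpsClosedForm {l : ℕ} (hl : 1 ≤ l) {k : ℝ → ℝ}
    (hk : EqOn k (tpsClosedForm l) (Ioo (-1 : ℝ) 1)) :
    IntegrableOn (fun x => k x * (1 - x ^ 2) ^ ((l : ℝ) - 1 / 2)) (Ioo (-1 : ℝ) 1) := by
  have h : IntegrableOn (tpsWeighted l) (Ioo (-1 : ℝ) 1) :=
    ((continuous_tpsWeighted hl).continuousOn.integrableOn_Icc).mono_set Ioo_subset_Icc_self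
  refine h.congr_fun (fun x hx => ?_) measurableSet_Ioo
  simp only [hk hx, tpsClosedForm_mul_weight l hx]

theorem gegenbauerInner_of_eqOn_tpsClosedForm {l : ℕ} (hl : 1 ≤ l) {k : ℝ → ℝ}
    (hk : EqOn k (tpsClosedForm l) (Ioo (-1 : ℝ) 1)) (n : ℕ) :
    gegenbauerInner l k (gegenbauerW l n) =
      (if n = 0 then 0 else ((n : ℝ) * (n + 2 * l))⁻¹) * tpsBeta ((l : ℝ) - 1 / 2) := by
  have hl' : (1 : ℝ) ≤ l := by exact_mod_cast hl
  rw [gegenbauerInner_eq_of_eqOn_tpsClosedForm hk]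
  split_ifs with hn
  · simp [hn, gegenbauerPoly_zero, integral_tpsWeighted hl]
  · have h := integral_tpsWeighted_mul_gegenbauerPoly hl n
    rw [integral_gegenbauerPoly_mul_weight hl' hn, add_zero] at h
    have h0 : (n * (n + 2 * l) : ℝ) ≠ 0 := by positivity
    rw [← h, inv_mul_cancel_left₀ h0]

theorem continuousOn_tpsClosedForm {l : ℕ} (hl : 1 ≤ l) :
    ContinuousOn (tpsClosedForm l) (Ioo (-1 : ℝ) 1) := fun _ hx =>
  (hasDerivAt_tpsClosedForm hl hx).continuousAt.continuousWithinAt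

/-! ### Existence: continuous extension to the endpoint `-1` -/

theorem tpsFlux_mem_Icc {l : ℕ} (hl : 1 ≤ l) {x : ℝ} (hx : x ∈ Ioc (-1 : ℝ) 0) :
    tpsFlux l x ∈ Icc 0 ((1 + x) * (1 - x ^ 2) ^ ((l : ℝ) - 1 / 2)) := by
  have hl' : (1 : ℝ) ≤ l := by exact_mod_cast hl
  have hw := continuous_one_sub_sq_rpow (p := (l : ℝ) - 1 / 2) (by linarith)
  rw [tpsFlux_eq_integral hl ⟨hx.1.le, by linarith [hx.2]⟩]
  constructor
  · refine intervalIntegral.integral_nonneg hx.1.le fun y hy => Real.rpow_nonneg ?_ _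
    nlinarith [hy.1, hy.2, hx.2]
  · refine (intervalIntegral.integral_mono_on hx.1.le (hw.intervalIntegrable _ _)
      (intervalIntegrable_const (c := (1 - x ^ 2) ^ ((l : ℝ) - 1 / 2))) fun y hy =>
      Real.rpow_le_rpow ?_ ?_ ?_).trans_eq ?_
    · nlinarith [hy.1, hy.2, hx.2]
    · nlinarith [hy.1, hy.2, hx.2]
    · linarith
    · rw [intervalIntegral.integral_const, smul_eq_mul]
      ring

/-- The weight increases on `[-1, 0]`, so the flux is at most `(1 + x) w(x)`. Hence the derivative
lies between `0` and `(1 + x)/(1 - x²) = 1/(1 - x) ≤ 1`, although individual terms of the closed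
form may blow up at `-1`. -/
theorem lipschitzOnWith_tpsClosedForm {l : ℕ} (hl : 1 ≤ l) :
    LipschitzOnWith 1 (tpsClosedForm l) (Ioc (-1 : ℝ) 0) := by
  refine (convex_Ioc _ _).lipschitzOnWith_of_nnnorm_hasDerivWithin_le
    (fun x hx => (hasDerivAt_tpsClosedForm hl
      ⟨hx.1, hx.2.trans_lt zero_lt_one⟩).hasDerivWithinAt) fun x hx => ?_
  have hs := one_sub_sq_pos (x := x) ⟨hx.1, hx.2.trans_lt zero_lt_one⟩
  obtain ⟨h1, h2⟩ := tpsFlux_mem_Icc hl hx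
  have hp := Real.rpow_pos_of_pos hs ((l : ℝ) - 1 / 2)
  rw [← NNReal.coe_le_coe, coe_nnnorm, Real.norm_of_nonneg
    (mul_nonneg h1 (Real.rpow_nonneg hs.le _)), Real.rpow_neg hs.le,
    show (l : ℝ) + 1 / 2 = l - 1 / 2 + 1 by ring, Real.rpow_add_one hs.ne', ← div_eq_mul_inv,
    NNReal.coe_one, div_le_one (mul_pos hp hs)]
  refine h2.trans ?_
  rw [mul_comm]
  exact mul_le_mul_of_nonneg_left (by nlinarith [hx.1, hx.2]) hp.le

theorem exists_continuousOn_eqOn_tpsClosedForm {l : ℕ} (hl : 1 ≤ l) :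
    ∃ k : ℝ → ℝ, ContinuousOn k (Ico (-1 : ℝ) 1) ∧ EqOn k (tpsClosedForm l) (Ioo (-1 : ℝ) 1) := by
  obtain ⟨g, hg, hge⟩ := (lipschitzOnWith_tpsClosedForm hl).extend_real
  set k : ℝ → ℝ := fun x => if x ≤ 0 then g x else tpsClosedForm l x with hk
  have hke : EqOn k (tpsClosedForm l) (Ioo (-1 : ℝ) 1) := by
    intro x hx
    simp only [hk]
    split_ifs with h0
    · exact (hge ⟨hx.1, h0⟩).symm
    · rfl
  refine ⟨k, fun x hx => ContinuousAt.continuousWithinAt ?_, hke⟩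
  -- For `x < 0`, including `-1`, the function agrees near `x` with the globally Lipschitz extension
  -- `g`; for `x ≥ 0` it agrees near `x` with the closed form, which settles the junction at `0`.
  rcases lt_or_ge x 0 with h0 | h0
  · refine hg.continuous.continuousAt.congr ?_
    filter_upwards [Iio_mem_nhds h0] with y hy
    simp only [hk, if_pos (mem_Iio.1 hy).le]
  · have hx' : x ∈ Ioo (-1 : ℝ) 1 := ⟨by linarith, hx.2⟩
    refine (hasDerivAt_tpsClosedForm hl hx').continuousAt.congr ?_
    filter_upwards [isOpen_Ioo.mem_nhds hx'] with y hy
    exact (hke hy).symm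

theorem mainTheorem3 (l : ℕ) (hl : 1 ≤ l) :
    (∃ k : ℝ → ℝ, IsThinplateSplineFunction (2 * l + 2) 1 k) ∧
    (∀ k : ℝ → ℝ, IsThinplateSplineFunction (2 * l + 2) 1 k →
      ∀ x ∈ Set.Ioo (-1 : ℝ) 1,
        k x = x * (Real.pi / 2 + Real.arcsin x) *
              (∑ j ∈ Finset.Icc 1 l, tpsC l j * (1 - x ^ 2) ^ (-(j : ℝ) + 1 / 2)) +
            (∑ j ∈ Finset.Icc 1 (l - 1), tpsD l j * (1 - x ^ 2) ^ (-(j : ℝ))) -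
            tpsConst l) ∧
    (∀ mu : ℝ, -1 < mu →
      tpsBeta mu = Real.sqrt Real.pi * Real.Gamma (mu + 1) / Real.Gamma (mu + 3 / 2)) := by
  refine ⟨?_, fun k hk => ?_, fun mu hmu => tpsBeta_eq_Gamma hmu⟩
  · obtain ⟨k, hkc, hke⟩ := exists_continuousOn_eqOn_tpsClosedForm hl
    exact ⟨k, (isThinplateSplineFunction_one_iff hl).2 ⟨hkc,
      integrableOn_of_eqOn_tpsClosedForm hl hke, gegenbauerInner_of_eqOn_tpsClosedForm hl hke⟩⟩
  · obtain ⟨hkc, hki, hkn⟩ := (isThinplateSplineFunction_one_iff hl).1 hk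
    refine eqOn_of_gegenbauerInner_eq (hkc.mono Ioo_subset_Ico_self)
      (continuousOn_tpsClosedForm hl) hki
      (integrableOn_of_eqOn_tpsClosedForm hl fun _ _ => rfl) fun n => ?_
    exact (hkn n).trans (gegenbauerInner_of_eqOn_tpsClosedForm hl (fun _ _ => rfl) n).symm
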